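/- Let $\mathfrak O$ be a compact discrete valuation ring with maximal ideal $\mathfrak P$ and residue field of size $q$, and write $\mathfrak O_n = \mathfrak O/\mathfrak P^n$. A module representation over a commutative ring $R$ is an $R$-linear map $\theta\colon M \to \operatorname{Hom}_R(V,W)$, where $M,V,W$ are $R$-modules; for a ring homomorphism $R\to S$, let $\theta^S\colon M\otimes_R S \to \operatorname{Hom}_S(V\otimes_R S, W\otimes_R S)$ denote its change of scalars. For a module representation $\theta$ over $\mathfrak O$ with $M,V,W$ finitely generated and an integer $m \ge 0$, the $\mathrm{ask}^m$ zeta function of $\theta$ is $$\mathsf Z^m_\theta(T) = \sum_{n=0}^\infty \mathrm{ask}^m(\theta^{\mathfrak O_n})\, T^n \in \mathbf Q[\![T]\!],$$ where $\mathrm{ask}^m(\theta) = \frac 1{|M|}\sum_{a\in M} |\operatorname{Ker}(a\theta)|^m$ for a module representation $\theta$ with $M$ and $V$ finite. For $d \ge 0$, define $c_d(X_1,\dotsc,X_d) \in \operatorname{Mat}_{\binom{d+1}2\times d}(\mathbf Z[X_1,\dotsc,X_d])$ recursively: $c_0$ is the $0\times 0$ matrix and, for $d \geq 1$, $$c_d(X_1,\dotsc,X_d)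 = \begin{bmatrix} X_1 1_d \\ \begin{array}{c|c} 0_{\binom d2\times 1} & c_{d-1}(X_2,\dotsc,X_d)\end{array}\end{bmatrix}.$$ Let $\gamma_d\colon \mathbf Z^d \to \operatorname{Mat}_{\binom{d+1}2\times d}(\mathbf Z) = \operatorname{Hom}(\mathbf Z^{\binom{d+1}2},\mathbf Z^d)$, $x\gamma_d = c_d(x)$, where matrices act on row vectors from the right, and let $\theta_d = \gamma_d^{\mathfrak O}$. Then, for all integers $d \ge 0$ and $m\ge 0$, $$\mathsf Z^m_{\theta_d}(T) = \frac 1{1-q^{m\binom{d+1}2-d}T}\cdot\prod_{j=0}^{d-1}\frac{1-q^{m\binom d2+(m-1)j-1}T}{1-q^{m\binom d2+(m-1)j}T}.$$ -/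

import Mathlib

open scoped TensorProduct

noncomputable section

namespace AskZeta

/-- Change of scalars of a module representation `θ : M → Hom(V, W)` over `R` along `R → S`:
the module representation `S ⊗ M → Hom(S ⊗ V, S ⊗ W)` over `S` with
`(s ⊗ a) ↦ (t ⊗ x ↦ (s * t) ⊗ (x (a θ)))`. -/
def changeScalars {R : Type*} (S : Type*) [CommRing R] [CommRing S] [Algebra R S]
    {M V W : Type*} [AddCommGroup M] [AddCommGroup V] [AddCommGroup W]
    [Module R M] [Module R V] [Module R W] (θ : M →ₗ[R] V →ₗ[R] W) :
    (S ⊗[R] M) →ₗ[S] (S ⊗[R] V) →ₗ[S] (S ⊗[R] W) :=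
  LinearMap.liftBaseChange S (LinearMap.baseChangeHom R S V W ∘ₗ θ)

/-- `(1 / |M|) * ∑_{a ∈ M} |Ker (a θ)| ^ m` for a module representation `θ : M → Hom(V, W)`
whose modules `M` and `V` are finite as sets (`∑ᶠ` is then the ordinary sum over `M`). -/
def askm {R : Type*} [CommRing R]
    {M V W : Type*} [AddCommGroup M] [AddCommGroup V] [AddCommGroup W]
    [Module R M] [Module R V] [Module R W] (θ : M →ₗ[R] V →ₗ[R] W) (m : ℕ) : ℚ :=
  (Nat.card M : ℚ)⁻¹ * ∑ᶠ a : M, (Nat.card (LinearMap.ker (θ a)) : ℚ) ^ m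

/-- The ask`^m` zeta function `∑_{n ≥ 0} askm (θ^{𝔒/𝔓^n}) m * T ^ n` of a module representation
of finitely generated modules over a compact discrete valuation ring `𝔒` with
maximal ideal `𝔓`. -/
def askmZeta {O : Type*} [CommRing O] [IsLocalRing O]
    {M V W : Type*} [AddCommGroup M] [AddCommGroup V] [AddCommGroup W]
    [Module O M] [Module O V] [Module O W] (θ : M →ₗ[O] V →ₗ[O] W) (m : ℕ) : PowerSeries ℚ :=
  PowerSeries.mk fun n => askm (changeScalars (O ⧸ IsLocalRing.maximalIdeal O ^ n) θ) m

/-- Splitting `(d+2).choose 2 = (d+1) + (d+1).choose 2` rows into the first `d+1` rows and the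
remaining ones, in order. -/
def rowEquiv (d : ℕ) :
    Fin ((d + 1 + 1).choose 2) ≃ Fin (d + 1) ⊕ Fin ((d + 1).choose 2) :=
  (finCongr (by rw [Nat.choose_succ_succ' (d + 1) 1, Nat.choose_one_right])).trans
    finSumFinEquiv.symm

/-- The matrix `c_d(x_1, …, x_d)` of size `(d+1).choose 2 × d`: its first `d` rows are
`x_1 1_d`, below these is the block matrix `[0 | c_{d-1}(x_2, …, x_d)]` whose first
column is zero. -/
def cMat {R : Type*} [CommRing R] :
    (d : ℕ) → (Fin d → R) → Matrix (Fin ((d + 1).choose 2)) (Fin d) R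
  | 0, _ => 0
  | d + 1, x =>
    (Matrix.fromRows (x 0 • (1 : Matrix (Fin (d + 1)) (Fin (d + 1)) R))
      (Matrix.of fun i j => (Fin.cons 0 (cMat d (Fin.tail x) i) : Fin (d + 1) → R) j)).submatrix
        (rowEquiv d) id

theorem cMat_add {R : Type*} [CommRing R] (d : ℕ) (x y : Fin d → R) :
    cMat d (x + y) = cMat d x + cMat d y := by
  induction d with
  | zero => simp [cMat]
  | succ d ih =>
    have ht : Fin.tail (x + y) = Fin.tail x + Fin.tail y := rfl
    ext i j
    simp only [cMat, ht, ih, Matrix.submatrix_apply, Matrix.add_apply, id]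
    rcases rowEquiv d i with k | k
    · simp [add_mul]
    · refine Fin.cases ?_ (fun l => ?_) j <;> simp

theorem cMat_smul {R : Type*} [CommRing R] (d : ℕ) (r : R) (x : Fin d → R) :
    cMat d (r • x) = r • cMat d x := by
  induction d with
  | zero => simp [cMat]
  | succ d ih =>
    have ht : Fin.tail (r • x) = r • Fin.tail x := rfl
    ext i j
    simp only [cMat, ht, ih, Matrix.submatrix_apply, Matrix.smul_apply, id]
    rcases rowEquiv d i with k | k
    · simp [mul_assoc]
    · refine Fin.cases ?_ (fun l => ?_) j <;> simp

/-- The module representation `γ_d : ℤ^d → Hom(ℤ^{(d+1).choose 2}, ℤ^d)`, `x γ_d = c_d(x)`, where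
matrices act on row vectors from the right. -/
def gamma (d : ℕ) : (Fin d → ℤ) →ₗ[ℤ] (Fin ((d + 1).choose 2) → ℤ) →ₗ[ℤ] (Fin d → ℤ) where
  toFun x := (cMat d x).vecMulLinear
  map_add' x y := by
    refine LinearMap.ext fun v => ?_
    simp [cMat_add]
  map_smul' r x := by
    refine LinearMap.ext fun v => ?_
    rw [cMat_smul]
    simp

end AskZeta

end

/-! The block shape of `cMat` makes its row space a product of ideals (x₁) × (x₁, x₂) × ⋯ × (x₁, …,
x_d) (`mem_range_cMat`), so over a finite ring R the kernel has |R| ^ (d+1 choose 2) elements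
divided by the product of the sizes of these ideals. For R = 𝔒/𝔓ⁿ the ideals form a chain of levels
𝔓ᵏ. Adjoining a uniformly random element to level k leaves it unchanged with probability q⁻ᵏ and
enlarges it to level i < k with probability (1 - q⁻¹)q⁻ⁱ. Averaging |Ker|^m thus reduces to the
recursion `chainWeight` with t = q^(m-1) (`weightSum_level`). On generating functions, one step of
it is X ↦ tX followed by multiplication by (1 - q⁻¹X)/(1 - X) (`mk_chainWeight_succ`), and iterating
gives the product. -/

namespace AskZeta

/-! ### Reduction to matrices over the quotient ring -/

section Scalars

/-- The identification `S ⊗ (R ⊗ ℤⁿ) ≃ Sⁿ`. -/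
noncomputable def baseChangePi (R S : Type*) [CommRing R] [CommRing S] [Algebra R S] (n : ℕ) :
    (S ⊗[R] (R ⊗[ℤ] (Fin n → ℤ))) ≃ₗ[S] (Fin n → S) :=
  (TensorProduct.AlgebraTensorModule.cancelBaseChange ℤ R S S (Fin n → ℤ)).trans
    (TensorProduct.piScalarRight ℤ S S (Fin n))

theorem baseChangePi_tmul {R S : Type*} [CommRing R] [CommRing S] [Algebra R S] {n : ℕ}
    (s : S) (r : R) (x : Fin n → ℤ) :
    baseChangePi R S n (s ⊗ₜ (r ⊗ₜ x)) = (r • s) • fun i => (x i : S) := by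
  ext i
  simp [baseChangePi, TensorProduct.piScalarRight_apply, mul_comm]

theorem cMat_map {R S : Type*} [CommRing R] [CommRing S] (f : R →+* S) (d : ℕ) (x : Fin d → R) :
    cMat d (fun i => f (x i)) = (cMat d x).map f := by
  induction d with
  | zero => ext i j; exact j.elim0
  | succ d ih =>
    have ht : Fin.tail (fun i => f (x i)) = fun i => f (Fin.tail x i) := rfl
    ext i j
    simp only [cMat, ht, ih, Matrix.submatrix_apply, Matrix.map_apply, id]
    rcases rowEquiv d i with k | k
    · simp [Matrix.one_apply, apply_ite f]
    · refine Fin.cases ?_ (fun l => ?_) j <;> simp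

theorem changeScalars_tmul {R S : Type*} [CommRing R] [CommRing S] [Algebra R S]
    {M V W : Type*} [AddCommGroup M] [AddCommGroup V] [AddCommGroup W]
    [Module R M] [Module R V] [Module R W] (θ : M →ₗ[R] V →ₗ[R] W) (s t : S) (a : M) (v : V) :
    changeScalars S θ (s ⊗ₜ a) (t ⊗ₜ v) = (s * t) ⊗ₜ θ a v := by
  simp [changeScalars, TensorProduct.smul_tmul']

theorem cMat_zero {R : Type*} [CommRing R] (d : ℕ) : cMat d (0 : Fin d → R) = 0 := by
  simpa using cMat_smul d (0 : R) 0

theorem baseChangePi_changeScalars_gamma {R S : Type*} [CommRing R] [CommRing S] [Algebra R S]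
    (d : ℕ) (a : S ⊗[R] (R ⊗[ℤ] (Fin d → ℤ)))
    (v : S ⊗[R] (R ⊗[ℤ] (Fin ((d + 1).choose 2) → ℤ))) :
    baseChangePi R S d (changeScalars S (changeScalars R (gamma d)) a v) =
      Matrix.vecMul (baseChangePi R S _ v) (cMat d (baseChangePi R S d a)) := by
  induction a with
  | zero => simp [cMat_zero]
  | add a b ha hb => simp [ha, hb, cMat_add, Matrix.vecMul_add]
  | tmul s a =>
    induction a with
    | zero => simp [cMat_zero]
    | add a b ha hb =>
      rw [TensorProduct.tmul_add]
      simp only [map_add, LinearMap.add_apply, ha, hb, cMat_add, Matrix.vecMul_add]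
    | tmul r x =>
      induction v with
      | zero => simp
      | add v w hv hw => simp only [map_add, hv, hw, Matrix.add_vecMul]
      | tmul t v =>
        induction v with
        | zero => simp
        | add v w hv hw =>
          generalize changeScalars S (changeScalars R (gamma d)) (s ⊗ₜ[R] (r ⊗ₜ[ℤ] x)) = φ at *
          rw [TensorProduct.tmul_add, φ.map_add, LinearEquiv.map_add, LinearEquiv.map_add, hv, hw,
            Matrix.add_vecMul]
        | tmul u y =>
          have h : changeScalars S (changeScalars R (gamma d)) (s ⊗ₜ[R] (r ⊗ₜ[ℤ] x))
              (t ⊗ₜ[R] (u ⊗ₜ[ℤ] y)) = (s * t) ⊗ₜ[R] ((r * u) ⊗ₜ[ℤ] (gamma d x y)) := by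
            rw [changeScalars_tmul, changeScalars_tmul]
          have hc : cMat d (fun i => (x i : S)) = (cMat d x).map (Int.castRingHom S) :=
            cMat_map (Int.castRingHom S) d x
          rw [h]
          simp only [baseChangePi_tmul, cMat_smul, Matrix.smul_vecMul, Matrix.vecMul_smul, hc]
          have hv : (fun i => ((gamma d x y i : ℤ) : S)) =
              Matrix.vecMul (fun i => (y i : S)) ((cMat d x).map (Int.castRingHom S)) := by
            have := RingHom.map_vecMul (Int.castRingHom S) (cMat d x) y
            ext i
            exact this i
          rw [hv, smul_smul]
          congr 1
          simp only [Algebra.smul_def, map_mul]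
          ring

theorem askm_changeScalars_gamma {R S : Type*} [CommRing R] [CommRing S] [Algebra R S]
    [Fintype S] (d m : ℕ) :
    askm (changeScalars S (changeScalars R (gamma d))) m =
      ((Nat.card S : ℚ) ^ d)⁻¹ *
        ∑ x : Fin d → S, (Nat.card (LinearMap.ker (cMat d x).vecMulLinear) : ℚ) ^ m := by
  rw [askm, Nat.card_congr (baseChangePi R S d).toEquiv, Nat.card_pi]
  congr 1
  · simp
  · rw [← finsum_eq_sum_of_fintype]
    refine finsum_eq_of_bijective (baseChangePi R S d) (baseChangePi R S d).bijective fun a => ?_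
    congr 2
    refine Nat.card_congr ((baseChangePi R S _).toEquiv.subtypeEquiv fun v => ?_)
    rw [LinearMap.mem_ker, LinearMap.mem_ker, ← (baseChangePi R S d).map_eq_zero_iff,
      baseChangePi_changeScalars_gamma]
    rfl

end Scalars

/-! ### Row space and kernel size of the matrix -/

section Kernel

theorem image_Iic_zero {α : Type*} {d : ℕ} (x : Fin (d + 1) → α) : x '' Set.Iic 0 = {x 0} := by
  ext y; simp [eq_comm, Set.mem_image]

theorem image_Iic_succ {α : Type*} {d : ℕ} (x : Fin (d + 1) → α) (j : Fin d) :
    x '' Set.Iic j.succ = insert (x 0) (Fin.tail x '' Set.Iic j) := by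
  ext y
  simp only [Set.mem_image, Set.mem_Iic, Set.mem_insert_iff, Fin.exists_fin_succ, Fin.zero_le,
    true_and, Fin.succ_le_succ_iff, Fin.tail]
  tauto

variable {R : Type*} [CommRing R]

theorem vecMul_cMat_succ (d : ℕ) (x : Fin (d + 1) → R) (v : Fin ((d + 1 + 1).choose 2) → R) :
    Matrix.vecMul v (cMat (d + 1) x) =
      x 0 • (fun j => v ((rowEquiv d).symm (Sum.inl j))) +
        (Fin.cons 0 (Matrix.vecMul (fun j => v ((rowEquiv d).symm (Sum.inr j)))
          (cMat d (Fin.tail x))) : Fin (d + 1) → R) := by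
  rw [cMat, Matrix.submatrix_vecMul_equiv, Matrix.vecMul_fromRows, Matrix.vecMul_smul,
    Matrix.vecMul_one]
  ext j
  refine Fin.cases ?_ (fun l => ?_) j <;> simp [Matrix.vecMul, dotProduct, Function.comp_def]

/-- The top block contributes an arbitrary multiple of x₁ to each coordinate, independently of the
lower block, which supplies the ideals of the tail by induction. -/
theorem mem_range_cMat {d : ℕ} {x w : Fin d → R} :
    w ∈ LinearMap.range (cMat d x).vecMulLinear ↔
      ∀ j, w j ∈ Ideal.span (x '' Set.Iic j) := by
  induction d with
  | zero => exact ⟨fun _ j => j.elim0, fun _ => ⟨0, Subsingleton.elim _ _⟩⟩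
  | succ d ih =>
    constructor
    · rintro ⟨v, rfl⟩ j
      have := vecMul_cMat_succ d x v
      rw [Matrix.vecMulLinear_apply, this]
      refine Fin.cases ?_ (fun j => ?_) j
      · rw [image_Iic_zero]
        simpa using Ideal.mul_mem_right _ _ (Ideal.mem_span_singleton_self (x 0))
      · rw [image_Iic_succ]
        refine Ideal.add_mem _ ?_ ?_
        · exact Ideal.mul_mem_right _ _ (Ideal.subset_span (Set.mem_insert _ _))
        · exact Ideal.span_mono (Set.subset_insert _ _) (ih.1 ⟨_, rfl⟩ j)
    · intro h
      have h1 := h 0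
      rw [image_Iic_zero, Ideal.mem_span_singleton'] at h1
      obtain ⟨a0, ha0⟩ := h1
      have h2 (j : Fin d) := h j.succ
      simp only [image_Iic_succ, Ideal.mem_span_insert] at h2
      choose a b hb hab using h2
      obtain ⟨u, hu⟩ := ih.2 hb
      -- The upper rows take the coefficients of `x 0`; the lower rows absorb the remainder `b`.
      refine ⟨fun i => Sum.elim (Fin.cons a0 a : Fin (d + 1) → R) u (rowEquiv d i), ?_⟩
      rw [Matrix.vecMulLinear_apply] at hu ⊢
      rw [vecMul_cMat_succ]
      ext j
      refine Fin.cases ?_ (fun j => ?_) j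
      · simp [← ha0, mul_comm]
      · simp [hab, hu, mul_comm]

theorem card_ker_cMat_mul [Finite R] {d : ℕ} (x : Fin d → R) :
    Nat.card (LinearMap.ker (cMat d x).vecMulLinear) *
      ∏ j, Nat.card (Ideal.span (x '' Set.Iic j)) = Nat.card R ^ (d + 1).choose 2 := by
  have h1 := Submodule.card_eq_card_quotient_mul_card (LinearMap.ker (cMat d x).vecMulLinear)
  rw [Nat.card_congr (cMat d x).vecMulLinear.quotKerEquivRange.toEquiv, Nat.card_pi] at h1
  have h2 : LinearMap.range (cMat d x).vecMulLinear ≃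
      ((j : Fin d) → Ideal.span (x '' Set.Iic j)) :=
    { toFun := fun w j => ⟨w.1 j, mem_range_cMat.1 w.2 j⟩
      invFun := fun w => ⟨fun j => w j, mem_range_cMat.2 fun j => (w j).2⟩
      left_inv := fun w => rfl
      right_inv := fun w => rfl }
  rw [Nat.card_congr h2, Nat.card_pi] at h1
  simpa [mul_comm] using h1.symm

end Kernel

open IsLocalRing

/-! ### The recursion and its generating function -/

section Chain

/-- The sum, over chains `k ≥ v₁ ≥ … ≥ v_d`, of the weights `t ^ (v₁ + ⋯ + v_d)` times the
probability that these are the truncated valuations of the ideals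
`(x₁), (x₁, x₂), …, (x₁, …, x_d)`. -/
def chainWeight (q t : ℚ) : ℕ → ℕ → ℚ
  | 0, _ => 1
  | d + 1, k => t ^ k * chainWeight q t d k +
      (1 - q⁻¹) * ∑ i ∈ Finset.range k, t ^ i * chainWeight q t d i

open PowerSeries

theorem one_sub_C_mul_X_ne_zero (a : ℚ) : constantCoeff (1 - C a * X : PowerSeries ℚ) ≠ 0 := by
  simp

theorem rescale_one_sub_C_mul_X (a b : ℚ) :
    rescale a (1 - C b * X) = (1 - C (a * b) * X : PowerSeries ℚ) := by
  have : rescale a (C b) = C b := by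
    ext n
    rcases n with _ | n <;> simp [coeff_C]
  rw [map_sub, map_mul, this, rescale_X, map_one, ← mul_assoc, ← map_mul, mul_comm b]

theorem rescale_inv_one_sub_C_mul_X (a b : ℚ) :
    rescale a (1 - C b * X)⁻¹ = (1 - C (a * b) * X : PowerSeries ℚ)⁻¹ := by
  rw [PowerSeries.eq_inv_iff_mul_eq_one (one_sub_C_mul_X_ne_zero _), ← rescale_one_sub_C_mul_X,
    ← map_mul, PowerSeries.inv_mul_cancel _ (one_sub_C_mul_X_ne_zero _), map_one]

/-- Consecutive differences telescope the sum in the recursion: with aₖ = tᵏ · `chainWeight q t d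
k`, they equal aₖ₊₁ - q⁻¹aₖ. -/
theorem mk_chainWeight_succ (q t : ℚ) (d : ℕ) :
    PowerSeries.mk (chainWeight q t (d + 1)) =
      rescale t (PowerSeries.mk (chainWeight q t d)) *
        ((1 - C q⁻¹ * X) * (1 - C 1 * X)⁻¹) := by
  rw [← mul_assoc, PowerSeries.eq_mul_inv_iff_mul_eq (one_sub_C_mul_X_ne_zero _), rescale_mk]
  ext n
  rcases n with _ | n
  · simp [chainWeight]
  · have h (φ : PowerSeries ℚ) (a : ℚ) : coeff (n + 1) (φ * (1 - C a * X)) =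
        coeff (n + 1) φ - coeff n φ * a := by
      rw [mul_sub, mul_one, map_sub, ← mul_assoc, coeff_succ_mul_X, coeff_mul_C]
    simp only [h, coeff_mk, chainWeight, Finset.sum_range_succ]
    ring

theorem mk_chainWeight (q t : ℚ) (d : ℕ) :
    PowerSeries.mk (chainWeight q t d) = (1 - C (t ^ d) * X : PowerSeries ℚ)⁻¹ *
      ∏ j ∈ Finset.range d, ((1 - C (t ^ j * q⁻¹) * X) * (1 - C (t ^ j) * X)⁻¹) := by
  induction d with
  | zero =>
    rw [Finset.prod_range_zero, mul_one,
      PowerSeries.eq_inv_iff_mul_eq_one (one_sub_C_mul_X_ne_zero _)]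
    ext n
    rcases n with _ | n
    · simp [chainWeight]
    · simp [mul_sub, coeff_succ_mul_X, chainWeight, coeff_one]
  | succ d ih =>
    rw [mk_chainWeight_succ, ih, map_mul, map_prod, Finset.prod_range_succ']
    simp only [map_mul (rescale t), rescale_inv_one_sub_C_mul_X, rescale_one_sub_C_mul_X]
    simp only [← mul_assoc, ← pow_succ', pow_zero, one_mul]

end Chain

/-! ### The chain of ideals in 𝔒/𝔓ⁿ -/

section Level

variable {O : Type*} [CommRing O] [IsDomain O] [IsDiscreteValuationRing O]

variable (O) in
/-- The image of the `k`th power of the maximal ideal in the quotient by the `n`th power. -/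
def level (n k : ℕ) : Ideal (O ⧸ maximalIdeal O ^ n) :=
  (maximalIdeal O ^ k).map (Ideal.Quotient.mk _)

theorem mk_mem_level {n k : ℕ} (hk : k ≤ n) {y : O} :
    Ideal.Quotient.mk _ y ∈ level O n k ↔ y ∈ maximalIdeal O ^ k :=
  Ideal.mem_quotient_iff_mem (Ideal.pow_le_pow_right hk)

theorem level_zero (n : ℕ) : level O n 0 = ⊤ := by
  simp [level, Ideal.map_top]

theorem level_self (n : ℕ) : level O n n = ⊥ :=
  Ideal.map_quotient_self _

theorem level_antitone (n : ℕ) : Antitone (level O n) := fun _ _ h =>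
  Ideal.map_mono (Ideal.pow_le_pow_right h)

theorem card_quotient_maximalIdeal_pow (n : ℕ) :
    Nat.card (O ⧸ maximalIdeal O ^ n) = Nat.card (ResidueField O) ^ n :=
  cardQuot_pow_of_prime (IsDiscreteValuationRing.not_a_field O)

theorem card_level_mul {n k : ℕ} (hk : k ≤ n) :
    Nat.card (level O n k) * Nat.card (ResidueField O) ^ k = Nat.card (ResidueField O) ^ n := by
  have h := Submodule.card_eq_card_quotient_mul_card (level O n k)
  have e : ((O ⧸ maximalIdeal O ^ n) ⧸ level O n k) ≃+* O ⧸ maximalIdeal O ^ k :=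
    DoubleQuot.quotQuotEquivQuotOfLE (Ideal.pow_le_pow_right hk)
  rw [Nat.card_congr e.toEquiv, card_quotient_maximalIdeal_pow,
    card_quotient_maximalIdeal_pow] at h
  rw [h, mul_comm]

/-- Such an `x` is the image of a unit times πⁱ, hence generates level `i` by itself. -/
theorem level_sup_span {n k i : ℕ} (hk : k ≤ n) (hi : i < k) {x : O ⧸ maximalIdeal O ^ n}
    (hx : x ∈ level O n i) (hx' : x ∉ level O n (i + 1)) :
    level O n k ⊔ Ideal.span {x} = level O n i := by
  refine le_antisymm (sup_le (level_antitone n hi.le) ?_) ((?_ : level O n i ≤ _).trans le_sup_right)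
  · rwa [Ideal.span_singleton_le_iff_mem]
  obtain ⟨y, rfl⟩ := Ideal.Quotient.mk_surjective x
  rw [mk_mem_level (hi.le.trans hk)] at hx
  rw [mk_mem_level (Nat.succ_le_of_lt (hi.trans_le hk))] at hx'
  obtain ⟨π, hπ⟩ := IsDiscreteValuationRing.exists_irreducible O
  have hP : maximalIdeal O = Ideal.span {π} := hπ.maximalIdeal_eq
  rw [hP, Ideal.span_singleton_pow, Ideal.mem_span_singleton] at hx hx'
  obtain ⟨z, rfl⟩ := hx
  have hz : IsUnit z := by
    by_contra hz
    rw [← mem_nonunits_iff, ← mem_maximalIdeal, hP, Ideal.mem_span_singleton] at hz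
    exact hx' (pow_succ π i ▸ mul_dvd_mul_left _ hz)
  have hPi : maximalIdeal O ^ i = Ideal.span {π ^ i} := by rw [hP, Ideal.span_singleton_pow]
  rw [level, Ideal.map_le_iff_le_comap, hPi, Ideal.span_singleton_le_iff_mem, Ideal.mem_comap,
    Ideal.mem_span_singleton]
  exact map_dvd _ (hz.mul_right_dvd.2 dvd_rfl)

theorem card_level {n k : ℕ} (hk : k ≤ n) {q : ℚ} (hq : q = Nat.card (ResidueField O))
    (hq0 : q ≠ 0) : (Nat.card (level O n k) : ℚ) = q ^ n * (q ^ k)⁻¹ := by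
  rw [eq_mul_inv_iff_mul_eq₀ (pow_ne_zero _ hq0), hq]
  exact_mod_cast card_level_mul hk

theorem sum_level_sup_span {n k : ℕ} [Fintype (O ⧸ maximalIdeal O ^ n)] (hk : k ≤ n)
    (g : Ideal (O ⧸ maximalIdeal O ^ n) → ℚ) :
    ∑ x, g (level O n k ⊔ Ideal.span {x}) =
      Nat.card (level O n k) * g (level O n k) + ∑ i ∈ Finset.range k,
        ((Nat.card (level O n i) : ℚ) - Nat.card (level O n (i + 1))) * g (level O n i) := by
  classical
  let F (j : ℕ) : Finset (O ⧸ maximalIdeal O ^ n) := {x | x ∈ level O n j}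
  have hF (j : ℕ) : (F j).card = Nat.card (level O n j) := by
    rw [Nat.card_eq_fintype_card, Fintype.card_subtype]
  have hanti (j : ℕ) : F (j + 1) ⊆ F j := fun x hx => by
    simp only [F, Finset.mem_filter_univ] at hx ⊢
    exact level_antitone n j.le_succ hx
  -- Peel off the shells `F i \ F (i + 1)`, on each of which the summand is constant.
  have key (j : ℕ) (hj : j ≤ k) : ∑ x, g (level O n k ⊔ Ideal.span {x}) =
      ∑ x ∈ F j, g (level O n k ⊔ Ideal.span {x}) + ∑ i ∈ Finset.range j,
        ((Nat.card (level O n i) : ℚ) - Nat.card (level O n (i + 1))) * g (level O n i) := by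
    induction j with
    | zero =>
      have : F 0 = Finset.univ := by simp [F, level_zero]
      rw [this, Finset.sum_range_zero, add_zero]
    | succ j ih =>
      have hc : ∑ x ∈ F j \ F (j + 1), g (level O n k ⊔ Ideal.span {x}) =
          ((Nat.card (level O n j) : ℚ) - Nat.card (level O n (j + 1))) * g (level O n j) := by
        rw [Finset.sum_congr rfl (g := fun _ => g (level O n j)), Finset.sum_const,
          nsmul_eq_mul, Finset.cast_card_sdiff (hanti j), hF, hF]
        intro x hx
        simp only [F, Finset.mem_sdiff, Finset.mem_filter_univ] at hx
        rw [level_sup_span hk hj hx.1 hx.2]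
      rw [ih (Nat.le_of_succ_le hj), ← Finset.sum_sdiff (hanti j), hc, Finset.sum_range_succ]
      ring
  rw [key k le_rfl, Finset.sum_congr rfl (g := fun _ => g (level O n k)), Finset.sum_const,
    nsmul_eq_mul, hF]
  intro x hx
  simp only [F, Finset.mem_filter_univ] at hx
  rw [sup_eq_left.2 ((Ideal.span_singleton_le_iff_mem _).2 hx)]

/-- Open subgroups of a compact group have finite index; the adic topology supplies the topological
ring structure. -/
theorem finite_quotient_maximalIdeal_pow [TopologicalSpace O] (hO : IsAdic (maximalIdeal O))
    [CompactSpace O] (n : ℕ) : Finite (O ⧸ maximalIdeal O ^ n) := by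
  have hr : IsTopologicalRing O := by
    rw [hO]
    exact (Ideal.nonarchimedean _).toIsTopologicalRing
  exact AddSubgroup.quotient_finite_of_isOpen (maximalIdeal O ^ n).toAddSubgroup
    ((isAdic_iff.1 hO).1 n)

end Level

/-! ### Summing over vectors one coordinate at a time -/

section Weight

variable {R : Type*} [CommRing R]

/-- The sum over `x ∈ R ^ d` of `∏ j, |I + (x₁, …, x_j)| ^ (-m)`. -/
noncomputable def weightSum [Fintype R] (m d : ℕ) (I : Ideal R) : ℚ :=
  ∑ x : Fin d → R, ∏ j, ((Nat.card ↥(I ⊔ Ideal.span (x '' Set.Iic j)) : ℚ) ^ m)⁻¹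

theorem weightSum_succ [Fintype R] (m d : ℕ) (I : Ideal R) :
    weightSum m (d + 1) I = ∑ a, ((Nat.card ↥(I ⊔ Ideal.span {a}) : ℚ) ^ m)⁻¹ *
      weightSum m d (I ⊔ Ideal.span {a}) := by
  rw [weightSum, ← (Fin.consEquiv fun _ => R).sum_comp, Fintype.sum_prod_type]
  refine Finset.sum_congr rfl fun a _ => ?_
  rw [weightSum, Finset.mul_sum]
  refine Finset.sum_congr rfl fun x _ => ?_
  simp only [Fin.prod_univ_succ, image_Iic_zero, image_Iic_succ, Fin.consEquiv_apply,
    Fin.cons_zero, Fin.tail_cons, Ideal.span_insert, ← sup_assoc]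

theorem sum_card_ker_cMat [Fintype R] (m d : ℕ) :
    ∑ x : Fin d → R, (Nat.card (LinearMap.ker (cMat d x).vecMulLinear) : ℚ) ^ m =
      ((Nat.card R : ℚ) ^ (d + 1).choose 2) ^ m * weightSum m d (⊥ : Ideal R) := by
  rw [weightSum, Finset.mul_sum]
  refine Finset.sum_congr rfl fun x _ => ?_
  have h : (Nat.card (LinearMap.ker (cMat d x).vecMulLinear) : ℚ) *
      ∏ j, (Nat.card (Ideal.span (x '' Set.Iic j)) : ℚ) = (Nat.card R : ℚ) ^ (d + 1).choose 2 := by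
    exact_mod_cast card_ker_cMat_mul x
  have h0 (j : Fin d) : (Nat.card (Ideal.span (x '' Set.Iic j)) : ℚ) ≠ 0 := by
    exact_mod_cast Nat.card_pos.ne'
  simp only [bot_sup_eq]
  rw [Finset.prod_inv_distrib, Finset.prod_pow, ← h, mul_pow, mul_inv_cancel_right₀]
  exact pow_ne_zero _ (Finset.prod_ne_zero_iff.2 fun j _ => h0 j)

variable {O : Type*} [CommRing O] [IsDomain O] [IsDiscreteValuationRing O]

/-- Level `i` has qⁿ⁻ⁱ elements: its inverse `m`th power gives qᵐⁱ and counting coordinates gives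
q⁻ⁱ, whence t = qᵐq⁻¹. The powers of qⁿ collect in front. -/
theorem weightSum_level {n k : ℕ} [Fintype (O ⧸ maximalIdeal O ^ n)] (hk : k ≤ n) (m d : ℕ)
    {q : ℚ} (hq : q = Nat.card (ResidueField O)) (hq0 : q ≠ 0) :
    weightSum m d (level O n k) =
      (q ^ n * ((q ^ n) ^ m)⁻¹) ^ d * chainWeight q (q ^ m * q⁻¹) d k := by
  induction d generalizing k with
  | zero => simp [weightSum, chainWeight]
  | succ d ih =>
    rw [weightSum_succ, sum_level_sup_span hk
      (fun I => ((Nat.card I : ℚ) ^ m)⁻¹ * weightSum m d I), ih hk, card_level hk hq hq0,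
      chainWeight, mul_add, Finset.mul_sum, Finset.mul_sum]
    congr 1
    · rw [mul_pow, mul_inv, inv_pow, inv_inv, mul_pow, inv_pow, pow_right_comm q k m]
      ring
    · refine Finset.sum_congr rfl fun i hi => ?_
      have hi' : i < n := (Finset.mem_range.1 hi).trans_le hk
      rw [ih hi'.le, card_level hi'.le hq hq0, card_level hi' hq hq0, mul_pow, mul_inv, inv_pow,
        inv_inv, mul_pow, inv_pow, pow_right_comm q i m, pow_succ q i, mul_inv]
      ring

theorem askm_quotient {n : ℕ} [Finite (O ⧸ maximalIdeal O ^ n)] (m d : ℕ)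
    {q : ℚ} (hq : q = Nat.card (ResidueField O)) (hq0 : q ≠ 0) :
    askm (changeScalars (O ⧸ maximalIdeal O ^ n) (changeScalars O (gamma d))) m =
      (q ^ (m * d.choose 2)) ^ n * chainWeight q (q ^ m * q⁻¹) d n := by
  have := Fintype.ofFinite (O ⧸ maximalIdeal O ^ n)
  have hc : (Nat.card (O ⧸ maximalIdeal O ^ n) : ℚ) = q ^ n := by
    rw [card_quotient_maximalIdeal_pow, hq, Nat.cast_pow]
  rw [askm_changeScalars_gamma, sum_card_ker_cMat, ← level_self, weightSum_level le_rfl m d hq hq0,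
    hc, Nat.choose_succ_succ' d 1, Nat.choose_one_right]
  have hn : q ^ n ≠ 0 := pow_ne_zero _ hq0
  rw [pow_right_comm q _ n]
  generalize q ^ n = Q at *
  rw [mul_pow, inv_pow, ← pow_mul]
  field_simp
  ring

end Weight

end AskZeta

open PowerSeries IsLocalRing in
theorem lemma6p12 (O : Type*) [CommRing O] [IsDomain O] [IsDiscreteValuationRing O]
    [TopologicalSpace O] (hO : IsAdic (maximalIdeal O)) [CompactSpace O]
    (d m : ℕ) (q : ℚ) (hq : q = Nat.card (ResidueField O)) :
    AskZeta.askmZeta (AskZeta.changeScalars O (AskZeta.gamma d)) m =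
      (1 - C (q ^ ((m : ℤ) * ((d + 1).choose 2 : ℤ) - (d : ℤ))) * X : PowerSeries ℚ)⁻¹ *
        ∏ j ∈ Finset.range d,
          ((1 - C (q ^ ((m : ℤ) * (d.choose 2 : ℤ) + ((m : ℤ) - 1) * (j : ℤ) - 1)) * X) *
            (1 - C (q ^ ((m : ℤ) * (d.choose 2 : ℤ) + ((m : ℤ) - 1) * (j : ℤ))) * X)⁻¹) := by
  have hfin (n : ℕ) : Finite (O ⧸ maximalIdeal O ^ n) :=
    AskZeta.finite_quotient_maximalIdeal_pow hO n
  -- `Nat.card` vanishes on infinite types, so this needs the residue field to be finite: the case n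
  -- = 1 of `hfin`.
  have hq0 : q ≠ 0 := by
    have h1 := AskZeta.card_quotient_maximalIdeal_pow (O := O) 1
    have h2 : Nat.card (O ⧸ maximalIdeal O ^ 1) ≠ 0 := Nat.card_pos.ne'
    rw [h1, pow_one] at h2
    rw [hq]
    exact_mod_cast h2
  have hpow (j : ℕ) : q ^ (m * d.choose 2) * (q ^ m * q⁻¹) ^ j =
      q ^ ((m : ℤ) * (d.choose 2 : ℤ) + ((m : ℤ) - 1) * (j : ℤ)) := by
    rw [zpow_add₀ hq0, zpow_mul, zpow_mul q _ (j : ℤ), zpow_sub_one₀ hq0]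
    simp only [zpow_natCast, pow_mul]
  -- The separate first factor is the j = d member of the family of denominators.
  have hlast : (m : ℤ) * ((d + 1).choose 2 : ℤ) - (d : ℤ) =
      (m : ℤ) * (d.choose 2 : ℤ) + ((m : ℤ) - 1) * (d : ℤ) := by
    rw [Nat.choose_succ_succ' d 1, Nat.choose_one_right]
    push_cast
    ring
  have h : AskZeta.askmZeta (AskZeta.changeScalars O (AskZeta.gamma d)) m =
      rescale (q ^ (m * d.choose 2))
        (PowerSeries.mk (AskZeta.chainWeight q (q ^ m * q⁻¹) d)) := by
    rw [rescale_mk, AskZeta.askmZeta]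
    congr 1
    ext n
    exact AskZeta.askm_quotient m d hq hq0
  rw [h, AskZeta.mk_chainWeight]
  simp only [map_mul (rescale _), map_prod, AskZeta.rescale_inv_one_sub_C_mul_X,
    AskZeta.rescale_one_sub_C_mul_X, hlast, zpow_sub_one₀ hq0, ← hpow, mul_assoc]
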